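/- Let $(D,\mu)$ be a probability space, let $n\ge 1$ be an integer, and let $V_n$ be an $n$-dimensional complex linear subspace of $B_\mu(D)$, the vector space of all bounded $\mu$-measurable functions $f\colon D\to\mathbb{C}$ (functions defined at every point of $D$, not identified when they agree almost everywhere; $\mu$-measurable means measurable with respect to the $\mu$-completion of the $\sigma$-algebra). Then there are points $x_1,\dots,x_{4n}\in D$, not necessarily distinct, such that, for all $f\in V_n$ and all $2\le p\le\infty$, $$ \|f\|_{L_p(\mu)} \;\le\; 83\cdot n^{\frac12-\frac1p}\cdot\Big(\frac{1}{4n}\sum_{k=1}^{4n}|f(x_k)|^2\Big)^{1/2}, $$ where $1/p=0$ for $p=\infty$ and $\|\cdot\|_{L_\infty(\mu)}$ is the $\mu$-essential supremum norm. -/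

import Mathlib

open MeasureTheory
open scoped ENNReal

/-- The complex vector space `B_μ(D)` of all bounded `μ`-measurable functions `f : D → ℂ`.
These are honest functions, not classes modulo equality almost everywhere, since they are
evaluated at points. `AEMeasurable f μ` says that `f` is measurable up to a `μ`-null set, that is,
measurable with respect to the completion of `μ`; this includes every measurable function. -/
def boundedMeasurable {D : Type*} [MeasurableSpace D] (μ : Measure D) : Submodule ℂ (D → ℂ) where
  carrier := {f | AEMeasurable f μ ∧ ∃ C : ℝ, ∀ x, ‖f x‖ ≤ C}
  zero_mem' := ⟨aemeasurable_const, 0, fun x => by simp⟩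
  add_mem' := by
    rintro f g ⟨hf, C, hC⟩ ⟨hg, C', hC'⟩
    exact ⟨hf.add hg, C + C', fun x => (norm_add_le _ _).trans (add_le_add (hC x) (hC' x))⟩
  smul_mem' := by
    rintro c f ⟨hf, C, hC⟩
    refine ⟨hf.const_smul c, ‖c‖ * C, fun x => ?_⟩
    rw [Pi.smul_apply, norm_smul]
    exact mul_le_mul_of_nonneg_left (hC x) (norm_nonneg c)

/-! The `4n` points are two families of `2n`: one controls the `L₂` norm, the other the sup norm,
and `eLpNorm_le_mul_rpow_of_two_of_top` interpolates.

For `L₂`, the matrices `u(x)u(x)*` of an orthonormal system average to the identity. Points are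
chosen one at a time so that the sum of these matrices stays above a barrier rising by `δ` per step,
while the trace of the inverse of (sum minus barrier) stays at most `φ`. A good next point exists by
averaging (`Matrix.PosDef.exists_barrier_step`), which reduces to `barrier_sum_inequality`. All
terms have weight one.

For the sup norm, points nearly maximising `det ∑ v(xₖ)v(xₖ)*` are taken. Adding a point `y` and
deleting one of the resulting points cannot raise the determinant above its supremum. Averaging over
deletions (`Matrix.sum_det_sub_vecMulVec`) bounds the leverage of `y`, and Cauchy–Schwarz bounds
`|f(y)|²` by a multiple of `∑ |f(xₖ)|²`. -/

/-! ### The lower barrier method -/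

open Matrix ComplexOrder in
theorem Matrix.IsHermitian.exists_unitary_diagonal {ι : Type*} [Fintype ι] [DecidableEq ι]
    {M : Matrix ι ι ℂ} (hM : M.IsHermitian) :
    ∃ U : Matrix ι ι ℂ, U * Uᴴ = 1 ∧ Uᴴ * U = 1 ∧
      M = U * diagonal (fun i => (hM.eigenvalues i : ℂ)) * Uᴴ := by
  refine ⟨hM.eigenvectorUnitary, ?_, ?_, ?_⟩
  · exact Unitary.coe_mul_star_self hM.eigenvectorUnitary
  · exact Unitary.coe_star_mul_self hM.eigenvectorUnitary
  · have h := hM.spectral_theorem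
    rw [Unitary.conjStarAlgAut_apply] at h
    exact h

/-- The scalar inequality behind the shift of the lower barrier in the method of
Batson, Spielman and Srivastava. -/
theorem barrier_sum_inequality {ι : Type*} [Fintype ι] {d : ι → ℝ} {φ δ : ℝ} (hδ : 0 < δ)
    (hδφ : δ * (1 + φ) = 1) (hd : ∀ i, δ < d i) (hsum : ∑ i, (d i)⁻¹ ≤ φ) :
    (∑ i, (d i - δ)⁻¹ - ∑ i, (d i)⁻¹) * (1 + ∑ i, (d i - δ)⁻¹) ≤ ∑ i, ((d i - δ)⁻¹) ^ 2 := by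
  have hp : ∀ i, 0 < d i - δ := fun i => sub_pos.2 (hd i)
  have hq : ∀ i, 0 < d i := fun i => hδ.trans (hd i)
  set P := ∑ i, (d i - δ)⁻¹ with hP
  set Q := ∑ i, (d i)⁻¹ with hQ
  have hQ0 : 0 ≤ Q := Finset.sum_nonneg fun i _ => (inv_pos.2 (hq i)).le
  have hΔ : P - Q = δ * ∑ i, (d i - δ)⁻¹ * (d i)⁻¹ := by
    rw [hP, hQ, ← Finset.sum_sub_distrib, Finset.mul_sum]
    refine Finset.sum_congr rfl fun i _ => ?_
    have := (hp i).ne'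
    have := (hq i).ne'
    field_simp
    ring
  set E := ∑ i, (d i - δ)⁻¹ * (d i)⁻¹ with hE
  have hE0 : 0 ≤ E := Finset.sum_nonneg fun i _ =>
    mul_nonneg (inv_pos.2 (hp i)).le (inv_pos.2 (hq i)).le
  set F := ∑ i, ((d i - δ)⁻¹) ^ 2 * (d i)⁻¹ with hF
  have hF0 : 0 ≤ F := Finset.sum_nonneg fun i _ =>
    mul_nonneg (sq_nonneg _) (inv_pos.2 (hq i)).le
  have hG : ∑ i, ((d i - δ)⁻¹) ^ 2 = E + δ * F := by
    rw [hE, hF, Finset.mul_sum, ← Finset.sum_add_distrib]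
    refine Finset.sum_congr rfl fun i _ => ?_
    have := (hp i).ne'
    have := (hq i).ne'
    field_simp
    ring
  have hCS : E ^ 2 ≤ F * Q := by
    refine Finset.sum_sq_le_sum_mul_sum_of_sq_le_mul _ (fun i _ => ?_) (fun i _ => ?_)
      (fun i _ => ?_)
    · exact mul_nonneg (sq_nonneg _) (inv_pos.2 (hq i)).le
    · exact (inv_pos.2 (hq i)).le
    · exact (by ring : _ = _).le
  have hδQ : δ * (1 + Q) ≤ 1 := by
    rw [← hδφ]
    exact mul_le_mul_of_nonneg_left (by linarith) hδ.le
  -- The claim becomes `δE(1 + Q) + (δE)² ≤ E + δF`, which holds term by term: the first by `δ(1 +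
  -- Q) ≤ 1`, the second by Cauchy–Schwarz.
  rw [hG, hΔ, show P = δ * E + Q by linarith]
  have h1 : δ * E * (1 + Q) ≤ E := by nlinarith
  have h2 : δ * E * (δ * E) ≤ δ * F := by
    have : δ * Q ≤ 1 := by nlinarith
    have h3 : F * (δ * Q) ≤ F := by nlinarith
    calc δ * E * (δ * E) = δ * (δ * E ^ 2) := by ring
      _ ≤ δ * (δ * (F * Q)) := by gcongr
      _ = δ * (F * (δ * Q)) := by ring
      _ ≤ δ * F := by gcongr
  nlinarith

open Matrix ComplexOrder in
-- Diagonalising `M` turns every trace into a sum over eigenvalues, so `barrier_sum_inequality`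
-- applies.
theorem Matrix.PosDef.barrier_shift {ι : Type*} [Fintype ι] [DecidableEq ι]
    {M : Matrix ι ι ℂ} (hM : M.PosDef) {φ δ : ℝ} (hδ : 0 < δ)
    (hδφ : δ * (1 + φ) = 1) (htr : (M⁻¹).trace.re ≤ φ) :
    (M - (δ : ℂ) • 1).PosDef ∧
      (((M - (δ : ℂ) • 1)⁻¹).trace.re - (M⁻¹).trace.re) * (1 + ((M - (δ : ℂ) • 1)⁻¹).trace.re) ≤
        ((M - (δ : ℂ) • 1)⁻¹ * (M - (δ : ℂ) • 1)⁻¹).trace.re := by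
  obtain ⟨U, hU, hU', hMU⟩ := hM.1.exists_unitary_diagonal
  have hpos := hM.eigenvalues_pos
  generalize hM.1.eigenvalues = d at hMU hpos
  have hmul : ∀ a b : ι → ℂ, U * diagonal a * Uᴴ * (U * diagonal b * Uᴴ) =
      U * diagonal (fun i => a i * b i) * Uᴴ := fun a b => by
    calc U * diagonal a * Uᴴ * (U * diagonal b * Uᴴ)
        = U * diagonal a * (Uᴴ * U) * diagonal b * Uᴴ := by simp only [Matrix.mul_assoc]
      _ = _ := by rw [hU', Matrix.mul_one, Matrix.mul_assoc U, diagonal_mul_diagonal]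
  have htrace : ∀ a : ι → ℂ, (U * diagonal a * Uᴴ).trace = ∑ i, a i := fun a => by
    rw [Matrix.trace_mul_comm, ← Matrix.mul_assoc, hU', Matrix.one_mul, trace_diagonal]
  have hinv : ∀ a : ι → ℝ, (∀ i, a i ≠ 0) →
      (U * diagonal (fun i => (a i : ℂ)) * Uᴴ)⁻¹ =
        U * diagonal (fun i => (((a i)⁻¹ : ℝ) : ℂ)) * Uᴴ := fun a ha => by
    refine Matrix.inv_eq_right_inv ?_
    rw [hmul]
    have : (fun i => (a i : ℂ) * (((a i)⁻¹ : ℝ) : ℂ)) = fun _ => 1 := by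
      funext i
      rw [← Complex.ofReal_mul, mul_inv_cancel₀ (ha i), Complex.ofReal_one]
    rw [this, diagonal_one, Matrix.mul_one, hU]
  have hMinv : (M⁻¹).trace.re = ∑ i, (d i)⁻¹ := by
    rw [hMU, hinv d fun i => (hpos i).ne', htrace, ← Complex.ofReal_sum, Complex.ofReal_re]
  have hN : M - (δ : ℂ) • 1 = U * diagonal (fun i => ((d i - δ : ℝ) : ℂ)) * Uᴴ := by
    have h1 : (δ : ℂ) • (1 : Matrix ι ι ℂ) = U * diagonal (fun _ => (δ : ℂ)) * Uᴴ := by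
      rw [show (fun _ : ι => (δ : ℂ)) = (δ : ℂ) • fun _ => 1 by ext; simp, diagonal_smul,
        diagonal_one, Matrix.mul_smul, Matrix.mul_one, Matrix.smul_mul, hU]
    rw [h1, hMU, ← Matrix.sub_mul, ← Matrix.mul_sub, diagonal_sub]
    simp
  -- The potential bounds each single term, so `d i ≥ 1/φ > 1/(1 + φ) = δ`: the barrier cannot jump
  -- past an eigenvalue.
  have hδd : ∀ i, δ < d i := fun i => by
    have h1 : (d i)⁻¹ ≤ φ := (Finset.single_le_sum (f := fun i => (d i)⁻¹)
      (fun j _ => (inv_pos.2 (hpos j)).le) (Finset.mem_univ i)).trans (hMinv ▸ htr)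
    have h2 : (d i)⁻¹ * d i = 1 := inv_mul_cancel₀ (hpos i).ne'
    have h3 : 1 ≤ φ * d i := h2 ▸ mul_le_mul_of_nonneg_right h1 (hpos i).le
    have h4 : δ ≤ δ * (φ * d i) := le_mul_of_one_le_right hδ.le h3
    have h5 : d i = δ * d i + δ * (φ * d i) := by
      linear_combination (-(d i)) * hδφ
    nlinarith [mul_pos hδ (hpos i)]
  have hNne : ∀ i, d i - δ ≠ 0 := fun i => (sub_pos.2 (hδd i)).ne'
  refine ⟨?_, ?_⟩
  · rw [hN]
    have hd : (diagonal (fun i => ((d i - δ : ℝ) : ℂ))).PosDef :=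
      PosDef.diagonal fun i => by
        simpa only [Complex.zero_lt_real, sub_pos] using hδd i
    refine hd.mul_mul_conjTranspose_same ?_
    intro x y hxy
    have := congrArg (fun z => z ᵥ* Uᴴ) hxy
    simpa [Matrix.vecMul_vecMul, hU] using this
  · have := barrier_sum_inequality hδ hδφ hδd (hMinv ▸ htr)
    rw [hMinv, hN, hinv _ hNne, hmul, htrace, htrace]
    simp only [← Complex.ofReal_mul, ← Complex.ofReal_sum, Complex.ofReal_re]
    simpa only [pow_two] using this

open Matrix ComplexOrder in
/-- The trace form of the Sherman–Morrison formula. -/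
theorem Matrix.PosDef.trace_inv_add_vecMulVec {ι : Type*} [Fintype ι] [DecidableEq ι]
    {N : Matrix ι ι ℂ} (hN : N.PosDef) (u : ι → ℂ) :
    ((N + vecMulVec u (star u))⁻¹).trace = (N⁻¹).trace -
      (star u ⬝ᵥ ((N⁻¹ * N⁻¹) *ᵥ u)) / (1 + star u ⬝ᵥ (N⁻¹ *ᵥ u)) := by
  set P := N⁻¹ with hP
  have hdet : IsUnit N.det := (Matrix.isUnit_iff_isUnit_det _).1 hN.isUnit
  have hNP : N * P = 1 := Matrix.mul_nonsing_inv _ hdet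
  set q := star u ⬝ᵥ (P *ᵥ u) with hq
  have hq0 : 0 ≤ q := hN.inv.posSemidef.dotProduct_mulVec_nonneg u
  have hq1 : 1 + q ≠ 0 := (add_pos_of_pos_of_nonneg one_pos hq0).ne'
  have hinv : (N + vecMulVec u (star u))⁻¹ =
      P - (1 + q)⁻¹ • vecMulVec (P *ᵥ u) (star u ᵥ* P) := by
    refine Matrix.inv_eq_right_inv ?_
    rw [Matrix.add_mul, Matrix.mul_sub, Matrix.mul_sub, hNP, Matrix.mul_smul, Matrix.mul_smul,
      Matrix.mul_vecMulVec, Matrix.mulVec_mulVec, hNP, Matrix.one_mulVec, Matrix.vecMulVec_mul,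
      Matrix.vecMulVec_mul_vecMulVec, ← hq, Matrix.vecMulVec_smul, smul_smul]
    have : vecMulVec u (star u ᵥ* P) = ((1 + q)⁻¹ + (1 + q)⁻¹ * q) •
        vecMulVec u (star u ᵥ* P) := by
      rw [show (1 + q)⁻¹ + (1 + q)⁻¹ * q = 1 by field_simp, one_smul]
    nth_rewrite 2 [this]
    rw [add_smul]
    abel
  rw [hinv, Matrix.trace_sub, Matrix.trace_smul, Matrix.trace_vecMulVec, dotProduct_comm,
    ← Matrix.dotProduct_mulVec, Matrix.mulVec_mulVec, smul_eq_mul, div_eq_inv_mul]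

open Matrix in
theorem integral_quadraticForm_eq_trace {D ι : Type*} [MeasurableSpace D] {μ : Measure D}
    [Fintype ι] [DecidableEq ι] {u : D → ι → ℂ}
    (hint : ∀ i j, Integrable (fun x => star (u x i) * u x j) μ)
    (horth : ∀ i j, ∫ x, star (u x i) * u x j ∂μ = if i = j then 1 else 0) (B : Matrix ι ι ℂ) :
    Integrable (fun x => star (u x) ⬝ᵥ (B *ᵥ u x)) μ ∧
      ∫ x, star (u x) ⬝ᵥ (B *ᵥ u x) ∂μ = B.trace := by
  have hexp : (fun x => star (u x) ⬝ᵥ (B *ᵥ u x)) =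
      fun x => ∑ i, ∑ j, B i j * (star (u x i) * u x j) := by
    funext x
    simp only [dotProduct, mulVec, Finset.mul_sum, Pi.star_apply]
    exact Finset.sum_congr rfl fun i _ => Finset.sum_congr rfl fun j _ => by ring
  have hij : ∀ i j, Integrable (fun x => B i j * (star (u x i) * u x j)) μ :=
    fun i j => (hint i j).const_mul _
  rw [hexp]
  refine ⟨integrable_finsetSum _ fun i _ => integrable_finsetSum _ fun j _ => hij i j, ?_⟩
  rw [integral_finsetSum _ fun i _ => integrable_finsetSum _ fun j _ => hij i j]
  simp only [integral_finsetSum _ fun j _ => hij _ j, integral_const_mul, horth]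
  simp [Matrix.trace]

open Matrix ComplexOrder in
/-- One step of the lower barrier argument: the barrier moves by `δ`, and for a suitable point the
rank-one update keeps the potential bounded by `φ`. -/
theorem Matrix.PosDef.exists_barrier_step {D ι : Type*} [MeasurableSpace D] {μ : Measure D}
    [IsProbabilityMeasure μ] [Fintype ι] [DecidableEq ι] {u : D → ι → ℂ}
    (hint : ∀ i j, Integrable (fun x => star (u x i) * u x j) μ)
    (horth : ∀ i j, ∫ x, star (u x i) * u x j ∂μ = if i = j then 1 else 0)
    {p : D → Prop} (hp : ∀ᵐ x ∂μ, p x) {M : Matrix ι ι ℂ} (hM : M.PosDef) {φ δ : ℝ} (hδ : 0 < δ)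
    (hδφ : δ * (1 + φ) = 1) (htr : (M⁻¹).trace.re ≤ φ) :
    ∃ x, p x ∧ (M - (δ : ℂ) • 1 + vecMulVec (u x) (star (u x))).PosDef ∧
      ((M - (δ : ℂ) • 1 + vecMulVec (u x) (star (u x)))⁻¹).trace.re ≤ φ := by
  obtain ⟨hN, hineq⟩ := hM.barrier_shift hδ hδφ htr
  set N := M - (δ : ℂ) • 1
  obtain ⟨hi1, he1⟩ := integral_quadraticForm_eq_trace hint horth (N⁻¹)
  obtain ⟨hi2, he2⟩ := integral_quadraticForm_eq_trace hint horth (N⁻¹ * N⁻¹)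
  set Δ := (N⁻¹).trace.re - (M⁻¹).trace.re with hΔ
  have hre1 : ∫ x, (star (u x) ⬝ᵥ (N⁻¹ *ᵥ u x)).re ∂μ = (N⁻¹).trace.re := by
    rw [← he1]; exact integral_re hi1
  have hre2 : ∫ x, (star (u x) ⬝ᵥ ((N⁻¹ * N⁻¹) *ᵥ u x)).re ∂μ = (N⁻¹ * N⁻¹).trace.re := by
    rw [← he2]; exact integral_re hi2
  have hg1 : Integrable (fun x => Δ * (1 + (star (u x) ⬝ᵥ (N⁻¹ *ᵥ u x)).re)) μ :=
    ((integrable_const 1).add hi1.re).const_mul Δ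
  have hg : Integrable (fun x => (star (u x) ⬝ᵥ ((N⁻¹ * N⁻¹) *ᵥ u x)).re -
      Δ * (1 + (star (u x) ⬝ᵥ (N⁻¹ *ᵥ u x)).re)) μ := hi2.re.sub hg1
  -- Some point off the null set does at least as well as the mean, which `hineq` makes nonnegative.
  obtain ⟨x, hxp, hx⟩ := exists_notMem_null_integral_le hg (ae_iff.1 hp)
  have hI : ∫ x, ((star (u x) ⬝ᵥ ((N⁻¹ * N⁻¹) *ᵥ u x)).re -
      Δ * (1 + (star (u x) ⬝ᵥ (N⁻¹ *ᵥ u x)).re)) ∂μ =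
      (N⁻¹ * N⁻¹).trace.re - Δ * (1 + (N⁻¹).trace.re) := by
    have hr1 : Integrable (fun x => (star (u x) ⬝ᵥ (N⁻¹ *ᵥ u x)).re) μ := hi1.re
    have hr2 : Integrable (fun x => (star (u x) ⬝ᵥ ((N⁻¹ * N⁻¹) *ᵥ u x)).re) μ := hi2.re
    rw [integral_sub hr2 hg1, integral_const_mul, integral_add (integrable_const 1) hr1, hre1, hre2]
    simp
  rw [hI] at hx
  refine ⟨x, not_not.1 hxp, hN.add_posSemidef (posSemidef_vecMulVec_self_star _), ?_⟩
  rw [hN.trace_inv_add_vecMulVec, Complex.sub_re]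
  have hq0 : 0 ≤ star (u x) ⬝ᵥ (N⁻¹ *ᵥ u x) := hN.inv.posSemidef.dotProduct_mulVec_nonneg _
  generalize star (u x) ⬝ᵥ (N⁻¹ *ᵥ u x) = q at hq0 hx
  obtain ⟨hqr, hqi⟩ := Complex.nonneg_iff.1 hq0
  have hq : (1 + q) = ((1 + q.re : ℝ) : ℂ) := by
    apply Complex.ext <;> simp [← hqi]
  rw [hq, Complex.div_ofReal_re]
  have hle : Δ ≤ (star (u x) ⬝ᵥ ((N⁻¹ * N⁻¹) *ᵥ u x)).re / (1 + q.re) := by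
    rw [le_div_iff₀ (by linarith)]
    linarith
  linarith

open Matrix ComplexOrder in
theorem exists_points_barrier {D ι : Type*} [MeasurableSpace D] {μ : Measure D}
    [IsProbabilityMeasure μ] [Fintype ι] [DecidableEq ι] {u : D → ι → ℂ}
    (hint : ∀ i j, Integrable (fun x => star (u x i) * u x j) μ)
    (horth : ∀ i j, ∫ x, star (u x i) * u x j ∂μ = if i = j then 1 else 0)
    {p : D → Prop} (hp : ∀ᵐ x ∂μ, p x) {φ δ t : ℝ} (ht : 0 < t) (hδ : 0 < δ)
    (hδφ : δ * (1 + φ) = 1) (hcard : Fintype.card ι ≤ φ * t) (m : ℕ) :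
    ∃ x : Fin m → D, (∀ k, p (x k)) ∧
      (((t - m * δ : ℝ) : ℂ) • 1 + ∑ k, vecMulVec (u (x k)) (star (u (x k)))).PosDef ∧
      ((((t - m * δ : ℝ) : ℂ) • (1 : Matrix ι ι ℂ) +
        ∑ k, vecMulVec (u (x k)) (star (u (x k))))⁻¹).trace.re ≤ φ := by
  induction m with
  | zero =>
    refine ⟨Fin.elim0, fun k => k.elim0, ?_, ?_⟩
    · have h : ((t : ℂ) • (1 : Matrix ι ι ℂ)).PosDef := PosDef.one.smul (Complex.zero_lt_real.2 ht)
      simpa only [CharP.cast_eq_zero, zero_mul, sub_zero, Finset.univ_eq_empty, Finset.sum_empty,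
        add_zero] using h
    -- The barrier starts at `-t`, where the potential is `card ι / t ≤ φ`.
    · have h : ((t : ℂ) • (1 : Matrix ι ι ℂ))⁻¹ = ((t⁻¹ : ℝ) : ℂ) • 1 := by
        refine Matrix.inv_eq_right_inv ?_
        rw [Matrix.smul_mul, Matrix.one_mul, smul_smul, ← Complex.ofReal_mul,
          mul_inv_cancel₀ ht.ne', Complex.ofReal_one, one_smul]
      simp only [CharP.cast_eq_zero, zero_mul, sub_zero, Finset.univ_eq_empty, Finset.sum_empty,
        add_zero]
      rw [h, Matrix.trace_smul, Matrix.trace_one, smul_eq_mul, Complex.re_ofReal_mul,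
        Complex.natCast_re, inv_mul_le_iff₀ ht]
      linarith
  | succ m ih =>
    obtain ⟨x, hxp, hpos, htr⟩ := ih
    obtain ⟨y, hyp, hy, hytr⟩ := hpos.exists_barrier_step hint horth hp hδ hδφ htr
    have hsum : ((t - m * δ : ℝ) : ℂ) • (1 : Matrix ι ι ℂ) +
        ∑ k, vecMulVec (u (x k)) (star (u (x k))) - (δ : ℂ) • 1 + vecMulVec (u y) (star (u y)) =
        ((t - (m + 1 : ℕ) * δ : ℝ) : ℂ) • 1 + ∑ k : Fin (m + 1),
          vecMulVec (u (Fin.snoc (α := fun _ => D) x y k))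
            (star (u (Fin.snoc (α := fun _ => D) x y k))) := by
      rw [Fin.sum_univ_castSucc]
      simp only [Fin.snoc_castSucc, Fin.snoc_last]
      rw [show ((t - (m + 1 : ℕ) * δ : ℝ) : ℂ) = ((t - m * δ : ℝ) : ℂ) - δ by push_cast; ring,
        sub_smul]
      abel
    rw [hsum] at hy hytr
    refine ⟨Fin.snoc (α := fun _ => D) x y, fun k => ?_, hy, hytr⟩
    refine Fin.lastCases ?_ (fun k => ?_) k
    · simpa using hyp
    · simpa using hxp k

open Matrix in
theorem star_dotProduct_sum_vecMulVec {ι κ : Type*} [Fintype ι] [Fintype κ] (v : κ → ι → ℂ)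
    (c : ι → ℂ) :
    star c ⬝ᵥ ((∑ k, vecMulVec (v k) (star (v k))) *ᵥ c) =
      ((∑ k, ‖star (v k) ⬝ᵥ c‖ ^ 2 : ℝ) : ℂ) := by
  rw [Matrix.sum_mulVec, dotProduct_sum, Complex.ofReal_sum]
  refine Finset.sum_congr rfl fun k _ => ?_
  rw [vecMulVec_mulVec, op_smul_eq_smul, dotProduct_smul, smul_eq_mul, Complex.ofReal_pow,
    ← Complex.mul_conj']
  congr 1
  rw [star_dotProduct, dotProduct_comm]
  rfl

open Matrix ComplexOrder in
/-- An orthonormal system in `L₂(μ)` admits an unweighted lower frame bound at well-chosen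
points. -/
theorem exists_points_lower_bound {D ι : Type*} [MeasurableSpace D] {μ : Measure D}
    [IsProbabilityMeasure μ] [Fintype ι] [DecidableEq ι] {u : D → ι → ℂ}
    (hint : ∀ i j, Integrable (fun x => star (u x i) * u x j) μ)
    (horth : ∀ i j, ∫ x, star (u x i) * u x j ∂μ = if i = j then 1 else 0)
    {p : D → Prop} (hp : ∀ᵐ x ∂μ, p x) {φ δ t : ℝ} (ht : 0 < t) (hδ : 0 < δ)
    (hδφ : δ * (1 + φ) = 1) (hcard : Fintype.card ι ≤ φ * t) (m : ℕ) :
    ∃ x : Fin m → D, (∀ k, p (x k)) ∧ ∀ c : ι → ℂ,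
      (m * δ - t) * ∑ i, ‖c i‖ ^ 2 ≤ ∑ k, ‖∑ i, c i * u (x k) i‖ ^ 2 := by
  obtain ⟨x, hxp, hpos, -⟩ := exists_points_barrier hint horth hp ht hδ hδφ hcard m
  refine ⟨x, hxp, fun c => ?_⟩
  have h := hpos.posSemidef.re_dotProduct_nonneg (star c)
  rw [Matrix.add_mulVec, dotProduct_add, Matrix.smul_mulVec, Matrix.one_mulVec,
    dotProduct_smul, star_dotProduct_sum_vecMulVec, star_star] at h
  have h1 : c ⬝ᵥ star c = ((∑ i, ‖c i‖ ^ 2 : ℝ) : ℂ) := by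
    rw [dotProduct, Complex.ofReal_sum]
    refine Finset.sum_congr rfl fun i _ => ?_
    rw [Complex.ofReal_pow, ← Complex.mul_conj']
    rfl
  have h2 : ∀ k, ‖star (u (x k)) ⬝ᵥ star c‖ = ‖∑ i, c i * u (x k) i‖ := fun k => by
    rw [Matrix.star_dotProduct_star, norm_star]
    rfl
  rw [h1, smul_eq_mul, ← Complex.ofReal_mul, ← Complex.ofReal_add] at h
  simp only [h2] at h
  have h3 : 0 ≤ (t - m * δ) * ∑ i, ‖c i‖ ^ 2 + ∑ k, ‖∑ i, c i * u (x k) i‖ ^ 2 := h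
  linarith

/-! ### Nearly determinant-maximising points and leverage -/

open Matrix in
theorem Matrix.det_add_vecMulVec {ι R : Type*} [Fintype ι] [DecidableEq ι] [CommRing R]
    {A : Matrix ι ι R} (hA : IsUnit A.det) (u w : ι → R) :
    (A + vecMulVec u w).det = A.det * (1 + w ⬝ᵥ (A⁻¹ *ᵥ u)) := by
  rw [vecMulVec_eq Unit, det_add_replicateCol_mul_replicateRow hA,
    det_unique (n := Unit), Matrix.mul_assoc,
    ← replicateCol_mulVec, Matrix.add_apply, Matrix.one_apply_eq,
    replicateRow_mul_replicateCol_apply]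

open Matrix in
/-- Removing one rank-one term at a time from a sum of `m` such terms multiplies the determinant
by `1 - card ι / m` on average. -/
theorem Matrix.sum_det_sub_vecMulVec {ι κ R : Type*} [Fintype ι] [DecidableEq ι] [Fintype κ]
    [CommRing R] (u w : κ → ι → R) (hB : IsUnit (∑ k, vecMulVec (u k) (w k)).det) :
    ∑ k, ((∑ l, vecMulVec (u l) (w l)) - vecMulVec (u k) (w k)).det =
      (∑ k, vecMulVec (u k) (w k)).det * (Fintype.card κ - Fintype.card ι) := by
  set B := ∑ k, vecMulVec (u k) (w k) with hBdef
  have hk : ∀ k, (B - vecMulVec (u k) (w k)).det = B.det * (1 - w k ⬝ᵥ (B⁻¹ *ᵥ u k)) := fun k => by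
    rw [sub_eq_add_neg, ← neg_vecMulVec, det_add_vecMulVec hB, mulVec_neg, dotProduct_neg,
      sub_eq_add_neg]
  have htr : ∑ k, w k ⬝ᵥ (B⁻¹ *ᵥ u k) = Fintype.card ι := by
    calc ∑ k, w k ⬝ᵥ (B⁻¹ *ᵥ u k) = ∑ k, (B⁻¹ * vecMulVec (u k) (w k)).trace := by
          refine Finset.sum_congr rfl fun k _ => ?_
          rw [mul_vecMulVec, trace_vecMulVec, dotProduct_comm]
      _ = (B⁻¹ * B).trace := by rw [← trace_sum, ← Matrix.mul_sum]
      _ = Fintype.card ι := by rw [nonsing_inv_mul _ hB, trace_one]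
  simp only [hk]
  rw [← Finset.mul_sum, Finset.sum_sub_distrib, htr]
  simp

open Matrix in
-- Makes the supremum of the determinants positive, so that near-maximisers are nonsingular.
theorem exists_det_sum_vecMulVec_ne_zero {D ι : Type*} [Fintype ι] [DecidableEq ι]
    {v : D → ι → ℂ} (hspan : Submodule.span ℂ (Set.range v) = ⊤) {m : ℕ}
    (hcard : Fintype.card ι ≤ m) (hD : Nonempty D) :
    ∃ x : Fin m → D, (∑ k, vecMulVec (v (x k)) (star (v (x k)))).det ≠ 0 := by
  obtain ⟨f, hf, hfspan, -⟩ := Submodule.exists_fun_fin_finrank_span_eq ℂ (Set.range v)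
  have hr : Module.finrank ℂ (Submodule.span ℂ (Set.range v)) ≤ m := by
    rw [hspan, finrank_top, Module.finrank_fintype_fun_eq_card]
    exact hcard
  choose y hy using hf
  obtain ⟨x, hx⟩ : ∃ x : Fin m → D, ∀ i, ∃ k, x k = y i := by
    -- A spanning subfamily uses at most `m` slots; an arbitrary point fills the rest.
    refine ⟨fun k => if h : k.1 < Module.finrank ℂ (Submodule.span ℂ (Set.range v)) then
      y ⟨k.1, h⟩ else hD.some, fun i => ⟨⟨i.1, i.2.trans_le hr⟩, ?_⟩⟩
    simp
  refine ⟨x, fun hdet => ?_⟩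
  obtain ⟨c, hc0, hc⟩ := Matrix.exists_mulVec_eq_zero_iff.2 hdet
  have h := star_dotProduct_sum_vecMulVec (fun k => v (x k)) c
  rw [hc, dotProduct_zero, eq_comm, Complex.ofReal_eq_zero,
    Finset.sum_eq_zero_iff_of_nonneg fun _ _ => sq_nonneg _] at h
  have hz : ∀ k, star c ⬝ᵥ v (x k) = 0 := fun k => by
    have := h k (Finset.mem_univ k)
    rw [sq_eq_zero_iff, norm_eq_zero] at this
    rw [star_dotProduct, dotProduct_comm, star_eq_zero, dotProduct_comm, this]
  have hall : ∀ w : ι → ℂ, star c ⬝ᵥ w = 0 := fun w => by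
    have hw : w ∈ Submodule.span ℂ (Set.range f) := by
      rw [hfspan, hspan]; trivial
    induction hw using Submodule.span_induction with
    | mem w hw =>
      obtain ⟨i, rfl⟩ := hw
      obtain ⟨k, hk⟩ := hx i
      rw [← hy, ← hk]
      exact hz k
    | zero => simp
    | add a b _ _ ha hb => rw [dotProduct_add, ha, hb, add_zero]
    | smul r a _ ha => rw [dotProduct_smul, ha, smul_zero]
  exact hc0 (star_eq_zero.1 (dotProduct_eq_zero _ hall))

open Matrix in
theorem bddAbove_norm_det_sum_vecMulVec {D ι : Type*} [Fintype ι] [DecidableEq ι]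
    {v : D → ι → ℂ} {C : ℝ} (hC : ∀ x i, ‖v x i‖ ≤ C) (m : ℕ) :
    BddAbove (Set.range fun x : Fin m → D =>
      ‖(∑ k, vecMulVec (v (x k)) (star (v (x k)))).det‖) := by
  refine ⟨(Fintype.card ι).factorial • (m * (C * C)) ^ Fintype.card ι, ?_⟩
  rintro _ ⟨x, rfl⟩
  refine Matrix.det_le (abv := NormedField.toAbsoluteValue ℂ) fun i j => ?_
  change ‖(∑ k, vecMulVec (v (x k)) (star (v (x k)))) i j‖ ≤ _
  rw [Matrix.sum_apply]
  refine (norm_sum_le _ _).trans ?_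
  calc ∑ k, ‖vecMulVec (v (x k)) (star (v (x k))) i j‖ ≤ ∑ _k : Fin m, C * C := by
        refine Finset.sum_le_sum fun k _ => ?_
        rw [vecMulVec_apply, Pi.star_apply, norm_mul, norm_star]
        exact mul_le_mul (hC _ _) (hC _ _) (norm_nonneg _) ((norm_nonneg _).trans (hC (x k) i))
    _ = m * (C * C) := by simp

open Matrix in
/-- A discrete form of the Kiefer–Wolfowitz theorem: points that nearly maximise the determinant
of the information matrix have bounded leverage. -/
theorem exists_points_leverage_bound {D ι : Type*} [Fintype ι] [DecidableEq ι] {v : D → ι → ℂ}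
    {C : ℝ} (hC : ∀ x i, ‖v x i‖ ≤ C) (hspan : Submodule.span ℂ (Set.range v) = ⊤) {m : ℕ}
    (hcard : Fintype.card ι ≤ m) (hD : Nonempty D) :
    ∃ x : Fin m → D, ∀ (c : ι → ℂ) (y : D),
      (m + 1 - Fintype.card ι : ℝ) * ‖∑ i, c i * v y i‖ ^ 2 ≤
        (m + 1 + Fintype.card ι) * ∑ k, ‖∑ i, c i * v (x k) i‖ ^ 2 := by
  have hbdd := bddAbove_norm_det_sum_vecMulVec hC m
  set s := ⨆ x : Fin m → D, ‖(∑ k, vecMulVec (v (x k)) (star (v (x k)))).det‖ with hs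
  obtain ⟨x₀, hx₀⟩ := exists_det_sum_vecMulVec_ne_zero hspan hcard hD
  have hs0 : 0 < s := (norm_pos_iff.2 hx₀).trans_le (le_ciSup hbdd x₀)
  -- The supremum need not be attained on `D`; coming within a factor `2` suffices.
  obtain ⟨x, hx⟩ := exists_lt_of_lt_ciSup (half_lt_self hs0)
  refine ⟨x, fun c y => ?_⟩
  set A := ∑ k, vecMulVec (v (x k)) (star (v (x k))) with hA
  have hAdet : IsUnit A.det :=
    isUnit_iff_ne_zero.2 (norm_pos_iff.1 ((half_pos hs0).trans hx))
  set w := A⁻¹ *ᵥ v y with hw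
  have hAw : A *ᵥ w = v y := by
    rw [hw, mulVec_mulVec, mul_nonsing_inv _ hAdet, one_mulVec]
  set H := ∑ k, ‖star (v (x k)) ⬝ᵥ w‖ ^ 2 with hH
  have hH0 : 0 ≤ H := Finset.sum_nonneg fun _ _ => sq_nonneg _
  have hh : star (v y) ⬝ᵥ w = (H : ℂ) := by
    rw [star_dotProduct, ← hAw, star_dotProduct_sum_vecMulVec, ← hH]
    exact Complex.conj_ofReal H
  set z : Fin (m + 1) → D := Fin.cons y x with hz
  have hB : ∑ k, vecMulVec (v (z k)) (star (v (z k))) = A + vecMulVec (v y) (star (v y)) := by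
    rw [Fin.sum_univ_succ, add_comm]
    simp [hz, hA]
  have hBdet : (A + vecMulVec (v y) (star (v y))).det = A.det * ((1 + H : ℝ) : ℂ) := by
    rw [Matrix.det_add_vecMulVec hAdet, ← hw, hh]
    push_cast
    rfl
  have hBunit : IsUnit (∑ k, vecMulVec (v (z k)) (star (v (z k)))).det := by
    rw [hB, hBdet]
    refine hAdet.mul (isUnit_iff_ne_zero.2 ?_)
    exact Complex.ofReal_ne_zero.2 (by positivity)
  have hsum := Matrix.sum_det_sub_vecMulVec (fun k => v (z k)) (fun k => star (v (z k))) hBunit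
  have hle : ‖∑ k, ((∑ l, vecMulVec (v (z l)) (star (v (z l)))) -
      vecMulVec (v (z k)) (star (v (z k)))).det‖ ≤ (m + 1) * s := by
    refine (norm_sum_le _ _).trans ?_
    calc _ ≤ ∑ _k : Fin (m + 1), s := by
          refine Finset.sum_le_sum fun k _ => ?_
          -- Deleting one of the `m + 1` points leaves an `m`-tuple, which competes in the supremum.
          rw [Fin.sum_univ_succAbove _ k, add_sub_cancel_left]
          exact le_ciSup hbdd fun l => z (k.succAbove l)
      _ = (m + 1) * s := by simp
  have hr : (Fintype.card ι : ℝ) ≤ m := by exact_mod_cast hcard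
  rw [hsum, hB, hBdet, norm_mul, norm_mul, Complex.norm_real, Real.norm_of_nonneg (by positivity),
    Fintype.card_fin, show (((m + 1 : ℕ) : ℂ) - (Fintype.card ι : ℂ)) =
      ((m + 1 - Fintype.card ι : ℝ) : ℂ) by push_cast; ring, Complex.norm_real,
    Real.norm_of_nonneg (by linarith)] at hle
  -- With `r = card ι`, near-maximality gives `(1 + H)(m + 1 - r) ≤ 2(m + 1)`.
  have hHle : (m + 1 - Fintype.card ι : ℝ) * H ≤ m + 1 + Fintype.card ι := by
    have hA0 : 0 < ‖A.det‖ := (half_pos hs0).trans hx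
    have h1 : ‖A.det‖ * ((1 + H) * (m + 1 - Fintype.card ι : ℝ)) ≤
        ‖A.det‖ * (2 * (m + 1)) := by
      have h2 : (m + 1 : ℝ) * s ≤ (m + 1) * (2 * ‖A.det‖) := by
        refine mul_le_mul_of_nonneg_left ?_ (by positivity)
        linarith
      linarith
    have h2 := le_of_mul_le_mul_left h1 hA0
    linarith
  have hval : ∑ i, c i * v y i = ∑ k, (∑ i, c i * v (x k) i) * (star (v (x k)) ⬝ᵥ w) := by
    change c ⬝ᵥ v y = ∑ k, (c ⬝ᵥ v (x k)) * (star (v (x k)) ⬝ᵥ w)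
    rw [← hAw, hA, sum_mulVec, dotProduct_sum]
    refine Finset.sum_congr rfl fun k _ => ?_
    rw [vecMulVec_mulVec, op_smul_eq_smul, dotProduct_smul, smul_eq_mul, mul_comm]
  have hCS : ‖∑ i, c i * v y i‖ ^ 2 ≤ (∑ k, ‖∑ i, c i * v (x k) i‖ ^ 2) * H := by
    rw [hval]
    calc _ ≤ (∑ k, ‖∑ i, c i * v (x k) i‖ * ‖star (v (x k)) ⬝ᵥ w‖) ^ 2 := by
          gcongr
          refine (norm_sum_le _ _).trans_eq ?_
          simp only [norm_mul]
      _ ≤ _ := Finset.sum_mul_sq_le_sq_mul_sq _ _ _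
  have hS0 : 0 ≤ ∑ k, ‖∑ i, c i * v (x k) i‖ ^ 2 := Finset.sum_nonneg fun _ _ => sq_nonneg _
  calc (m + 1 - Fintype.card ι : ℝ) * ‖∑ i, c i * v y i‖ ^ 2
      ≤ (m + 1 - Fintype.card ι : ℝ) * ((∑ k, ‖∑ i, c i * v (x k) i‖ ^ 2) * H) :=
        mul_le_mul_of_nonneg_left hCS (by linarith)
    _ = ((m + 1 - Fintype.card ι : ℝ) * H) * ∑ k, ‖∑ i, c i * v (x k) i‖ ^ 2 := by ring
    _ ≤ _ := mul_le_mul_of_nonneg_right hHle hS0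

/-! ### From frame bounds to norms of functions -/

/-- Interpolation between `L₂` and `L_∞`. -/
theorem eLpNorm_le_mul_rpow_of_two_of_top {D : Type*} [MeasurableSpace D] {μ : Measure D}
    {f : D → ℂ} {a c : ℝ≥0∞} (ha : a ≠ ⊤) (hc : c ≠ ⊤) (h2 : eLpNorm f 2 μ ≤ a)
    (htop : ∀ x, ‖f x‖ₑ ≤ a * c) {p : ℝ≥0∞} (hp : 2 ≤ p) :
    eLpNorm f p μ ≤ a * c ^ (1 - 2 * (p⁻¹).toReal) := by
  rcases eq_or_ne p ⊤ with rfl | hpt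
  · simpa [eLpNorm_exponent_top] using! eLpNormEssSup_le_of_ae_enorm_bound (.of_forall htop)
  have hp0 : p ≠ 0 := (two_pos.trans_le hp).ne'
  set q := p.toReal with hq
  have hq2 : 2 ≤ q := by
    rw [hq, ← ENNReal.toReal_ofNat]
    exact ENNReal.toReal_mono hpt hp
  have hq0 : 0 < q := by linarith
  rw [eLpNorm_eq_lintegral_rpow_enorm_toReal two_ne_zero ENNReal.ofNat_ne_top,
    ENNReal.toReal_ofNat, one_div, ENNReal.rpow_inv_le_iff two_pos] at h2
  rw [eLpNorm_eq_lintegral_rpow_enorm_toReal hp0 hpt, ← hq, one_div, ENNReal.rpow_inv_le_iff hq0,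
    ENNReal.toReal_inv, ← hq, ENNReal.mul_rpow_of_nonneg _ _ hq0.le, ← ENNReal.rpow_mul,
    show (1 - 2 * q⁻¹) * q = q - 2 by field_simp]
  have hb : (a * c) ^ (q - 2) ≠ ⊤ :=
    ENNReal.rpow_ne_top_of_nonneg (by linarith) (ENNReal.mul_ne_top ha hc)
  calc ∫⁻ x, ‖f x‖ₑ ^ q ∂μ ≤ ∫⁻ x, ‖f x‖ₑ ^ (2 : ℝ) * (a * c) ^ (q - 2) ∂μ := by
        refine lintegral_mono fun x => ?_
        rw [show q = 2 + (q - 2) by ring, ENNReal.rpow_add_of_nonneg _ _ two_pos.le (by linarith),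
          show 2 + (q - 2) - 2 = q - 2 by ring]
        exact mul_le_mul_right (ENNReal.rpow_le_rpow (htop x) (by linarith)) _
    _ = (∫⁻ x, ‖f x‖ₑ ^ (2 : ℝ) ∂μ) * (a * c) ^ (q - 2) := lintegral_mul_const' _ _ hb
    _ ≤ a ^ (2 : ℝ) * (a * c) ^ (q - 2) := by gcongr
    _ = a ^ q * c ^ (q - 2) := by
        rw [ENNReal.mul_rpow_of_nonneg _ _ (by linarith : 0 ≤ q - 2), ← mul_assoc,
          ← ENNReal.rpow_add_of_nonneg _ _ two_pos.le (by linarith), add_sub_cancel]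

theorem integrable_star_mul_of_mem_boundedMeasurable {D : Type*} [MeasurableSpace D]
    {μ : Measure D} [IsFiniteMeasure μ] {f g : D → ℂ} (hf : f ∈ boundedMeasurable μ)
    (hg : g ∈ boundedMeasurable μ) : Integrable (fun x => star (f x) * g x) μ := by
  obtain ⟨hfm, C, hC⟩ := hf
  obtain ⟨hgm, C', hC'⟩ := hg
  refine Integrable.of_bound (C := C * C')
    ((continuous_star.comp_aestronglyMeasurable hfm.aestronglyMeasurable).mul
      hgm.aestronglyMeasurable) (.of_forall fun x => ?_)
  rw [norm_mul, norm_star]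
  exact mul_le_mul (hC x) (hC' x) (norm_nonneg _) ((norm_nonneg _).trans (hC x))

theorem integral_star_sum_mul_sum {D ι : Type*} [MeasurableSpace D] {μ : Measure D} [Fintype ι]
    {e : ι → D → ℂ} (hint : ∀ i j, Integrable (fun x => star (e i x) * e j x) μ) (c d : ι → ℂ) :
    ∫ x, star (∑ i, c i * e i x) * ∑ j, d j * e j x ∂μ =
      ∑ i, ∑ j, star (c i) * d j * ∫ x, star (e i x) * e j x ∂μ := by
  have hexp : ∀ x, star (∑ i, c i * e i x) * ∑ j, d j * e j x =
      ∑ i, ∑ j, star (c i) * d j * (star (e i x) * e j x) := fun x => by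
    rw [star_sum, Finset.sum_mul_sum]
    refine Finset.sum_congr rfl fun i _ => Finset.sum_congr rfl fun j _ => ?_
    rw [star_mul']
    ring
  simp only [hexp]
  have hij : ∀ i j, Integrable (fun x => star (c i) * d j * (star (e i x) * e j x)) μ :=
    fun i j => (hint i j).const_mul _
  rw [integral_finsetSum _ fun i _ => integrable_finsetSum _ fun j _ => hij i j]
  simp only [integral_finsetSum _ fun j _ => hij _ j, integral_const_mul]

theorem Module.Basis.apply_eq_sum_repr_mul {D ι : Type*} [Fintype ι] {V : Submodule ℂ (D → ℂ)}
    (b : Module.Basis ι ℂ V) {f : D → ℂ} (hf : f ∈ V) (x : D) :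
    f x = ∑ i, b.repr ⟨f, hf⟩ i * (b i : D → ℂ) x := by
  have h := congrFun (congrArg Subtype.val (b.sum_repr ⟨f, hf⟩)) x
  rw [Submodule.coe_sum, Finset.sum_apply] at h
  exact h.symm

open Matrix in
/-- A finite-dimensional space of bounded functions is spanned by functions that are pairwise
orthogonal in `L₂(μ)`; some of them may vanish almost everywhere. -/
theorem exists_orthogonal_spanning {D ι : Type*} [MeasurableSpace D] {μ : Measure D}
    [IsFiniteMeasure μ] [Fintype ι] [DecidableEq ι] {V : Submodule ℂ (D → ℂ)}
    (hV : V ≤ boundedMeasurable μ) (b : Module.Basis ι ℂ V) :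
    ∃ (e : ι → D → ℂ) (l : ι → ℝ), (∀ i, e i ∈ V) ∧
      (∀ f ∈ V, ∃ c : ι → ℂ, ∀ x, f x = ∑ i, c i * e i x) ∧
      ∀ i j, ∫ x, star (e i x) * e j x ∂μ = if i = j then (l i : ℂ) else 0 := by
  have hint : ∀ i j, Integrable (fun x => star ((b i : D → ℂ) x) * (b j : D → ℂ) x) μ :=
    fun i j => integrable_star_mul_of_mem_boundedMeasurable (hV (b i).2) (hV (b j).2)
  set G : Matrix ι ι ℂ := of fun i j => ∫ x, star ((b i : D → ℂ) x) * (b j : D → ℂ) x ∂μ with hG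
  have hGh : G.IsHermitian := by
    ext i j
    rw [conjTranspose_apply, hG, of_apply, of_apply]
    change (starRingEnd ℂ) _ = _
    rw [← integral_conj]
    refine integral_congr_ae (.of_forall fun x => ?_)
    simp [mul_comm]
  obtain ⟨U, hU, hU', hGU⟩ := hGh.exists_unitary_diagonal
  generalize hGh.eigenvalues = l at hGU
  refine ⟨fun i x => ∑ j, U j i * (b j : D → ℂ) x, l, fun i => ?_, fun f hf => ?_,
    fun i j => ?_⟩
  · have h : (fun x => ∑ j, U j i * (b j : D → ℂ) x) = ∑ j, U j i • (b j : D → ℂ) := by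
      ext x
      simp
    change (fun x => ∑ j, U j i * (b j : D → ℂ) x) ∈ V
    rw [h]
    exact V.sum_mem fun j _ => V.smul_mem _ (b j).2
  · refine ⟨fun i => ∑ k, b.repr ⟨f, hf⟩ k * star (U k i), fun x => ?_⟩
    have hUU : ∀ k j, ∑ i, U j i * star (U k i) = if j = k then 1 else 0 := fun k j => by
      have := congrFun (congrFun hU j) k
      rw [mul_apply, one_apply] at this
      exact this
    calc f x = ∑ k, ∑ j, b.repr ⟨f, hf⟩ k * (if j = k then 1 else 0) * (b j : D → ℂ) x := by
          rw [b.apply_eq_sum_repr_mul hf]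
          simp
      _ = ∑ k, ∑ j, ∑ i, b.repr ⟨f, hf⟩ k * star (U k i) * (U j i * (b j : D → ℂ) x) := by
          refine Finset.sum_congr rfl fun k _ => Finset.sum_congr rfl fun j _ => ?_
          rw [← hUU, Finset.mul_sum, Finset.sum_mul]
          exact Finset.sum_congr rfl fun i _ => by ring
      _ = ∑ i, ∑ k, ∑ j, b.repr ⟨f, hf⟩ k * star (U k i) * (U j i * (b j : D → ℂ) x) := by
          exact (Finset.sum_congr rfl fun k _ => Finset.sum_comm).trans Finset.sum_comm
      _ = _ := by
          simp only [Finset.sum_mul_sum]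
  · rw [integral_star_sum_mul_sum hint]
    have h1 : Uᴴ * G * U = diagonal fun i => (l i : ℂ) := by
      rw [hGU]
      calc Uᴴ * (U * (diagonal fun i => (l i : ℂ)) * Uᴴ) * U
          = (Uᴴ * U) * (diagonal fun i => (l i : ℂ)) * (Uᴴ * U) := by
            simp only [Matrix.mul_assoc]
        _ = _ := by rw [hU', Matrix.one_mul, Matrix.mul_one]
    have h2 := congrFun (congrFun h1 i) j
    rw [Matrix.mul_assoc, mul_apply, diagonal_apply] at h2
    rw [← h2]
    refine Finset.sum_congr rfl fun k _ => ?_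
    rw [mul_apply, Finset.mul_sum]
    refine Finset.sum_congr rfl fun k' _ => ?_
    rw [conjTranspose_apply, hG, of_apply]
    ring

/-- Equal-weight discretisation of the `L₂(μ)` norm from below on a finite-dimensional space. -/
theorem exists_points_integral_le {D ι : Type*} [MeasurableSpace D] {μ : Measure D}
    [IsProbabilityMeasure μ] [Fintype ι] [DecidableEq ι] {V : Submodule ℂ (D → ℂ)}
    (hV : V ≤ boundedMeasurable μ) (b : Module.Basis ι ℂ V) {φ δ t : ℝ} (ht : 0 < t) (hδ : 0 < δ)
    (hδφ : δ * (1 + φ) = 1) (hcard : Fintype.card ι ≤ φ * t) (m : ℕ) :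
    ∃ x : Fin m → D, ∀ f ∈ V,
      (m * δ - t) * ∫ y, ‖f y‖ ^ 2 ∂μ ≤ ∑ k, ‖f (x k)‖ ^ 2 := by
  obtain ⟨e, l, heV, hspan, horth⟩ := exists_orthogonal_spanning hV b
  have hint : ∀ i j, Integrable (fun x => star (e i x) * e j x) μ :=
    fun i j => integrable_star_mul_of_mem_boundedMeasurable (hV (heV i)) (hV (heV j))
  have hsq : ∀ z : ℂ, star z * z = ((‖z‖ ^ 2 : ℝ) : ℂ) := fun z => by
    rw [Complex.ofReal_pow]
    exact Complex.conj_mul' z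
  have hle : ∀ i, ∫ x, ‖e i x‖ ^ 2 ∂μ = l i := fun i => by
    have := horth i i
    simp only [hsq, if_true] at this
    rw [integral_complex_ofReal] at this
    exact_mod_cast this
  have hl0 : ∀ i, 0 ≤ l i := fun i => hle i ▸ integral_nonneg fun _ => sq_nonneg _
  -- Nonzero functions in `V` may vanish almost everywhere, so they cannot be normalised. Sampling
  -- only where all the null `e i` vanish lets them be dropped from every sum.
  have hnull : ∀ᵐ x ∂μ, ∀ i, l i = 0 → e i x = 0 := by
    rw [ae_all_iff]
    intro i
    by_cases hi : l i = 0
    · have hi' : Integrable (fun x => ‖e i x‖ ^ 2) μ := by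
        have := (hint i i).re
        simpa only [hsq, RCLike.re_eq_complex_re, Complex.ofReal_re] using this
      have := (integral_eq_zero_iff_of_nonneg (fun _ => sq_nonneg _) hi').1 ((hle i).trans hi)
      filter_upwards [this] with x hx _
      simpa using hx
    · exact .of_forall fun x h => absurd h hi
  have hr : ∀ i, 0 < l i → ((√(l i) : ℝ) : ℂ) ≠ 0 := fun i hi =>
    Complex.ofReal_ne_zero.2 (Real.sqrt_pos.2 hi).ne'
  let u : D → {i // 0 < l i} → ℂ := fun x i => ((√(l i) : ℝ) : ℂ)⁻¹ * e i x
  have hstar : ∀ x i j, star (u x i) * u x j =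
      (((√(l i.1) : ℝ) : ℂ)⁻¹ * ((√(l j.1) : ℝ) : ℂ)⁻¹) * (star (e i.1 x) * e j.1 x) :=
    fun x i j => by
      simp only [u, star_mul', star_inv₀, Complex.star_def, Complex.conj_ofReal]
      ring
  have huint : ∀ i j, Integrable (fun x => star (u x i) * u x j) μ := fun i j => by
    simp only [hstar]
    exact (hint _ _).const_mul _
  have huorth : ∀ i j, ∫ x, star (u x i) * u x j ∂μ = if i = j then 1 else 0 := fun i j => by
    simp only [hstar, integral_const_mul, horth, ← Subtype.ext_iff]
    split_ifs with hij
    · subst hij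
      have h1 : (l i.1 : ℂ) = ((√(l i.1) : ℝ) : ℂ) * ((√(l i.1) : ℝ) : ℂ) := by
        rw [← Complex.ofReal_mul, Real.mul_self_sqrt (hl0 _)]
      rw [h1]
      have := hr i.1 i.2
      field_simp
    · simp
  have hc : (Fintype.card {i // 0 < l i} : ℝ) ≤ φ * t :=
    (Nat.cast_le.2 (Fintype.card_subtype_le _)).trans hcard
  obtain ⟨x, hx, hlow⟩ := exists_points_lower_bound huint huorth hnull ht hδ hδφ hc m
  refine ⟨x, fun f hf => ?_⟩
  obtain ⟨c, hfc⟩ := hspan f hf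
  have hsub : ∀ {E : Type} [AddCommMonoid E] (F : ι → E), (∀ i, l i = 0 → F i = 0) →
      ∑ i, F i = ∑ i : {i // 0 < l i}, F i := fun F hF =>
    (Finset.sum_filter_of_ne fun i _ hi =>
      (hl0 i).lt_of_ne' fun h => hi (hF i h)).symm.trans (Finset.sum_subtype _ (by simp) F)
  have hnorm : ∫ y, ‖f y‖ ^ 2 ∂μ = ∑ i : {i // 0 < l i}, ‖c i * ((√(l i) : ℝ) : ℂ)‖ ^ 2 := by
    have h1 : ∫ y, star (f y) * f y ∂μ = ((∑ i, ‖c i‖ ^ 2 * l i : ℝ) : ℂ) := by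
      simp only [hfc]
      rw [integral_star_sum_mul_sum hint, Complex.ofReal_sum]
      refine Finset.sum_congr rfl fun i _ => ?_
      simp only [horth, mul_ite, mul_zero, Finset.sum_ite_eq, Finset.mem_univ, if_true, hsq]
      rw [Complex.ofReal_mul]
    simp only [hsq] at h1
    rw [integral_complex_ofReal, Complex.ofReal_inj] at h1
    rw [h1, hsub _ fun i hi => by rw [hi, mul_zero]]
    refine Finset.sum_congr rfl fun i _ => ?_
    rw [norm_mul, Complex.norm_real, mul_pow, Real.norm_eq_abs, sq_abs, Real.sq_sqrt (hl0 _)]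
  have hval : ∀ k, f (x k) = ∑ i : {i // 0 < l i}, c i * ((√(l i) : ℝ) : ℂ) * u (x k) i :=
    fun k => by
      rw [hfc, hsub _ fun i hi => by rw [hx k i hi, mul_zero]]
      refine Finset.sum_congr rfl fun i _ => ?_
      have := hr i.1 i.2
      simp only [u]
      field_simp
  rw [hnorm]
  simp only [hval]
  exact hlow _

open Matrix in
-- A functional killing every evaluation vector is a pointwise linear relation among the basis
-- functions, hence zero.
theorem Module.Basis.span_range_eval_eq_top {D ι : Type*} [Fintype ι] [DecidableEq ι]
    {V : Submodule ℂ (D → ℂ)} (b : Module.Basis ι ℂ V) :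
    Submodule.span ℂ (Set.range fun (x : D) (i : ι) => (b i : D → ℂ) x) = ⊤ := by
  by_contra hne
  obtain ⟨g, hg0, hg⟩ := Submodule.exists_le_ker_of_lt_top _ (lt_top_iff_ne_top.2 hne)
  have hgv : ∀ w : ι → ℂ, g w = ∑ i, w i * g (fun j => if i = j then 1 else 0) :=
    fun w => g.pi_apply_eq_sum_univ w
  have hz : ∑ i, g (fun j => if i = j then 1 else 0) • b i = 0 := by
    ext x
    have h1 : g (fun i => (b i : D → ℂ) x) = 0 :=
      hg (Submodule.subset_span ⟨x, rfl⟩)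
    rw [hgv] at h1
    simpa [mul_comm] using h1
  have hli := Fintype.linearIndependent_iff.1 b.linearIndependent _ hz
  exact hg0 (LinearMap.ext fun w => by simp [hgv w, hli])

/-! ### Choice of parameters and conclusion -/

theorem theorem3p3 {D : Type*} [MeasurableSpace D] (μ : Measure D) [IsProbabilityMeasure μ]
    (n : ℕ) (V : Submodule ℂ (D → ℂ)) (hVB : V ≤ boundedMeasurable μ)
    (hVn : Module.rank ℂ V = (n : Cardinal)) :
    ∃ x : Fin (4 * n) → D, ∀ f ∈ V, ∀ p : ℝ≥0∞, 2 ≤ p →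
      eLpNorm f p μ ≤ ENNReal.ofReal
        (83 * (n : ℝ) ^ ((1 : ℝ) / 2 - (p⁻¹).toReal) *
          ((1 / (4 * (n : ℝ)) * ∑ k, ‖f (x k)‖ ^ 2) ^ ((1 : ℝ) / 2))) := by
  have hD : Nonempty D := nonempty_of_isProbabilityMeasure μ
  rcases Nat.eq_zero_or_pos n with rfl | hn
  · rw [Nat.cast_zero, rank_zero_iff] at hVn
    refine ⟨fun _ => hD.some, fun f hf p _ => ?_⟩
    have h0 : f = 0 := congrArg Subtype.val (Subsingleton.elim (⟨f, hf⟩ : V) 0)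
    simp [h0]
  have hfin : Module.Finite ℂ V := Module.finite_of_rank_eq_nat hVn
  let b : Module.Basis (Fin n) ℂ V :=
    Module.finBasisOfFinrankEq ℂ V (Module.finrank_eq_of_rank_eq hVn)
  have hn0 : (0 : ℝ) < n := Nat.cast_pos.2 hn
  -- After `2n` steps the barrier is at `2n/3 - n/2 = n/6`.
  obtain ⟨x, hx⟩ := exists_points_integral_le hVB b (φ := 2) (δ := 1 / 3) (t := n / 2)
    (by positivity) (by norm_num) (by norm_num) (by rw [Fintype.card_fin]; linarith) (2 * n)
  obtain ⟨C, hC⟩ : ∃ C : ℝ, ∀ (y : D) (i : Fin n), ‖(b i : D → ℂ) y‖ ≤ C := by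
    choose C hC using fun i => (hVB (b i).2).2
    obtain ⟨K, hK⟩ := (Set.finite_range C).bddAbove
    exact ⟨K, fun y i => (hC i y).trans (hK ⟨i, rfl⟩)⟩
  obtain ⟨y, hy⟩ := exists_points_leverage_bound hC b.span_range_eval_eq_top (m := 2 * n)
    (by rw [Fintype.card_fin]; linarith) hD
  have h4 : 4 * n = 2 * n + 2 * n := by ring
  refine ⟨Fin.append y x ∘ Fin.cast h4, fun f hf p hp => ?_⟩
  have hsum : ∑ k, ‖f ((Fin.append y x ∘ Fin.cast h4) k)‖ ^ 2 =
      ∑ k, ‖f (y k)‖ ^ 2 + ∑ k, ‖f (x k)‖ ^ 2 := by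
    calc _ = ∑ k : Fin (2 * n + 2 * n), ‖f (Fin.append y x k)‖ ^ 2 :=
          Fintype.sum_equiv (finCongr h4) _ _ fun _ => rfl
      _ = _ := by
          simp only [Fin.sum_univ_add, Fin.append_left, Fin.append_right]
  rw [hsum]
  set S₁ := ∑ k, ‖f (y k)‖ ^ 2 with hS₁
  set S₂ := ∑ k, ‖f (x k)‖ ^ 2 with hS₂
  have hS₁0 : 0 ≤ S₁ := Finset.sum_nonneg fun _ _ => sq_nonneg _
  have hS₂0 : 0 ≤ S₂ := Finset.sum_nonneg fun _ _ => sq_nonneg _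
  set R := (1 / (4 * (n : ℝ)) * (S₁ + S₂)) ^ ((1 : ℝ) / 2) with hR
  have hR0 : 0 ≤ R := by positivity
  have hRsq : 4 * n * R ^ 2 = S₁ + S₂ := by
    rw [hR, ← Real.sqrt_eq_rpow, Real.sq_sqrt (by positivity)]
    field_simp
  have h2 : eLpNorm f 2 μ ≤ ENNReal.ofReal (83 * R) := by
    obtain ⟨hfm, K, hK⟩ := hVB hf
    have hmem : MemLp f 2 μ := MemLp.of_bound hfm.aestronglyMeasurable K (.of_forall hK)
    rw [hmem.eLpNorm_eq_integral_rpow_norm two_ne_zero ENNReal.ofNat_ne_top]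
    simp only [ENNReal.toReal_ofNat, Real.rpow_ofNat]
    refine ENNReal.ofReal_le_ofReal ?_
    rw [← one_div, ← Real.sqrt_eq_rpow]
    refine Real.sqrt_le_iff.2 ⟨by positivity, ?_⟩
    have h := hx f hf
    push_cast at h
    -- From `(n/6)∫|f|² ≤ S₂ ≤ 4nR²`; the constant `83` leaves ample room over `√24`.
    have h' : n * ∫ y, ‖f y‖ ^ 2 ∂μ ≤ n * (24 * R ^ 2) := by
      linarith
    have := le_of_mul_le_mul_left h' hn0
    nlinarith [sq_nonneg R]
  have htop : ∀ z, ‖f z‖ₑ ≤ ENNReal.ofReal (83 * R) * ENNReal.ofReal (n ^ ((1 : ℝ) / 2)) :=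
    fun z => by
      rw [← ENNReal.ofReal_mul (by positivity), ← ofReal_norm]
      refine ENNReal.ofReal_le_ofReal ?_
      have hfb : ∀ w, f w = ∑ i, b.repr ⟨f, hf⟩ i * (b i : D → ℂ) w := b.apply_eq_sum_repr_mul hf
      have h := hy (fun i => b.repr ⟨f, hf⟩ i) z
      simp only [← hfb] at h
      rw [Fintype.card_fin, ← hS₁] at h
      push_cast at h
      -- With `m = 2n` the leverage factor is `(3n + 1)/(n + 1) ≤ 3`, so `|f(z)|² ≤ 3S₁ ≤ 12nR²`.
      have h3 : (n + 1 : ℝ) * ‖f z‖ ^ 2 ≤ (n + 1) * (3 * S₁) := by linarith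
      have h4 := le_of_mul_le_mul_left h3 (by positivity)
      refine le_of_sq_le_sq ?_ (by positivity)
      rw [mul_pow, mul_pow, ← Real.sqrt_eq_rpow, Real.sq_sqrt hn0.le]
      nlinarith [mul_nonneg hn0.le (sq_nonneg R)]
  refine (eLpNorm_le_mul_rpow_of_two_of_top ENNReal.ofReal_ne_top ENNReal.ofReal_ne_top h2 htop
    hp).trans_eq ?_
  have hp1 : 2 * (p⁻¹).toReal ≤ 1 := by
    have : (p⁻¹).toReal ≤ ((2 : ℝ≥0∞)⁻¹).toReal :=
      ENNReal.toReal_mono (by simp) (ENNReal.inv_le_inv.2 hp)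
    rw [ENNReal.toReal_inv 2, ENNReal.toReal_ofNat] at this
    linarith
  rw [ENNReal.ofReal_rpow_of_nonneg (by positivity) (by linarith),
    ← ENNReal.ofReal_mul (by positivity), ← Real.rpow_mul hn0.le]
  congr 1
  rw [show (1 : ℝ) / 2 * (1 - 2 * (p⁻¹).toReal) = 1 / 2 - (p⁻¹).toReal by ring]
  ring
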